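/- Let $\mathbb{S}\subset\mathbb{R}$ be a finite set and let $Y=(Y_t)_{t\ge 0}$ be a right-continuous continuous-time Markov chain with state space $\mathbb{S}$ and transition rate matrix $G$ (that is, $G(x,y)\ge 0$ for $x\ne y$ and $G(x,x)=-\sum_{y\neq x}G(x,y)$, and the transition function of $Y$ is $e^{tG}$); $\mathbb{E}_x$ denotes expectation for the chain started at $Y_0=x\in\mathbb{S}$. Let $a>0$ and $f:\mathbb{S}\to\mathbb{C}$. Define the drawdown times without recovery by $\tilde\tau_{a,0}=0$ and $$\tilde\tau_{a,n}=\inf\Big\{t>\tilde\tau_{a,n-1}:\ \sup_{\tilde\tau_{a,n-1}\le u\le t}Y_u-Y_t\ge a\Big\},\qquad n\ge 1,$$ with $\inf\emptyset=\infty$, and for $q\in\mathbb{C}$ with $\operatorname{Re} q>0$, $x\in\mathbb{S}$ and $n\ge 0$ put $$H_n(q,x)=\mathbb{E}_x\big[e^{-q\tilde\tau_{a,n}}f(Y_{\tilde\tau_{a,n}})\big],$$ where the random variable in the bracket is $0$ on $\{\tilde\tau_{a,n}=\infty\}$. For $A\subseteq\mathbb{R}$ let $T_A=\inf\{t>0: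 Y_t\notin A\}$, and for $k,g:\mathbb{S}\to\mathbb{C}$ let $$P_A(k,x;g)=\mathbb{E}_x\Big[e^{-\int_0^{T_A}k(Y_s)\,ds}\,\mathbf{1}_{\{T_A<\infty\}}\,g(Y_{T_A})\Big];$$ write $P_A(q,x;g)$ when $k\equiv q$ is constant. Proposition. Let $q\in\mathbb{C}$ with $\operatorname{Re} q>0$. All the expectations appearing below are those of integrable random variables, $H_0(q,x)=f(x)$ for every $x\in\mathbb{S}$, and for every $n\ge 1$ and every $x\in\mathbb{S}$, $$H_n(q,x)=P_{(x-a,x]}\big(q,x;\,H_{n-1}(q,\cdot)\,\mathbf{1}_{\{\cdot\le x-a\}}\big)+\sum_{y\in\mathbb{S},\,y>x}P_{(x-a,x]}\big(q,x;\,\mathbf{1}_{\{\cdot=y\}}\big)\,H_n(q,y).$$ -/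

import Mathlib

open MeasureTheory
open scoped NNReal ENNReal

/-- `G` is a transition rate matrix on the finite state space `S`: the off-diagonal entries are
nonnegative and `G x x = -∑_{y ≠ x} G x y`. -/
def IsRateMatrix {S : Finset ℝ} (G : Matrix S S ℝ) : Prop :=
  (∀ x y : S, x ≠ y → 0 ≤ G x y) ∧
    ∀ x : S, G x x = -∑ y ∈ Finset.univ.filter (fun y : S => y ≠ x), G x y

/-- A continuous-time Markov chain with finite state space `S ⊆ ℝ` and transition rate matrix `G`,
realised on a measurable space `Ω`: a right-continuous `S`-valued process `(Y_t)_{t ≥ 0}` together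
with probability measures `P x` (the law of the chain started at `x`), whose transition function
is the matrix semigroup `exp (t G)`. -/
structure MarkovChain {S : Finset ℝ} (G : Matrix S S ℝ) (Ω : Type*) [MeasurableSpace Ω] where
  /-- the law under which the chain starts at `x` -/
  P : S → Measure Ω
  isProbabilityMeasure : ∀ x, IsProbabilityMeasure (P x)
  /-- the state `Y_t` at time `t` -/
  Y : ℝ≥0 → Ω → S
  measurable_Y : ∀ t, Measurable (Y t)
  rightContinuous : ∀ ω t, ContinuousWithinAt (fun s => Y s ω) (Set.Ici t) t
  /-- the finite-dimensional distributions: for `0 = t₀ ≤ t₁ ≤ ⋯ ≤ t_m` and states `x = z₀, …, z_m`,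
  `P_x(Y_{t₀} = z₀, …, Y_{t_m} = z_m) = ∏_{i < m} exp((t_{i+1} - t_i) G)(z_i, z_{i+1})`;
  for `m = 0` this says `P_x(Y_0 = x) = 1` -/
  finiteDimensional : ∀ (x : S) (m : ℕ) (t : ℕ → ℝ≥0) (z : ℕ → S),
    Monotone t → t 0 = 0 → z 0 = x →
      (P x).real {ω | ∀ i ≤ m, Y (t i) ω = z i} =
        ∏ i ∈ Finset.range m,
          (NormedSpace.exp (((t (i + 1) : ℝ) - (t i : ℝ)) • G) : Matrix S S ℝ) (z i) (z (i + 1))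

namespace MarkovChain

variable {S : Finset ℝ} {G : Matrix S S ℝ} {Ω : Type*} [MeasurableSpace Ω]

/-- The first passage time `T_A = inf {t > 0 : Y_t ∉ A}`, with `inf ∅ = ∞`. -/
noncomputable def passageTime (M : MarkovChain G Ω) (A : Set ℝ) (ω : Ω) : ℝ≥0∞ :=
  sInf {T : ℝ≥0∞ | ∃ t : ℝ≥0, T = t ∧ 0 < t ∧ (M.Y t ω : ℝ) ∉ A}

/-- The random variable `exp(-∫_0^{T_A} k(Y_s) ds) 1_{T_A < ∞} g(Y_{T_A})`. -/
noncomputable def passagePayoff (M : MarkovChain G Ω) (A : Set ℝ) (k g : S → ℂ) (ω : Ω) : ℂ :=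
  if M.passageTime A ω < ∞ then
    Complex.exp (-∫ s in (0 : ℝ)..(M.passageTime A ω).toReal, k (M.Y s.toNNReal ω)) *
      g (M.Y (M.passageTime A ω).toNNReal ω)
  else 0

/-- The quantity `P_A(k, x; g) = E_x[exp(-∫_0^{T_A} k(Y_s) ds) 1_{T_A < ∞} g(Y_{T_A})]`. -/
noncomputable def passageExpectation (M : MarkovChain G Ω) (A : Set ℝ) (k : S → ℂ) (x : S)
    (g : S → ℂ) : ℂ :=
  ∫ ω, M.passagePayoff A k g ω ∂(M.P x)

/-- The running maximum `sup_{s ≤ u ≤ t} Y_u` over the time window `[s, t]` (used for `s ≤ t`). -/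
noncomputable def runningMax (M : MarkovChain G Ω) (s t : ℝ≥0) (ω : Ω) : ℝ :=
  sSup ((fun u => (M.Y u ω : ℝ)) '' Set.Icc s t)

/-- The `n`-th drawdown time without recovery: `τ_0 = 0` and
`τ_{n+1} = inf {t > τ_n : sup_{τ_n ≤ u ≤ t} Y_u - Y_t ≥ a}`, with `inf ∅ = ∞`. -/
noncomputable def drawdownTime (M : MarkovChain G Ω) (a : ℝ) : ℕ → Ω → ℝ≥0∞
  | 0, _ => 0
  | n + 1, ω => sInf {T : ℝ≥0∞ | ∃ t : ℝ≥0, T = t ∧ M.drawdownTime a n ω < t ∧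
      a ≤ M.runningMax (M.drawdownTime a n ω).toNNReal t ω - (M.Y t ω : ℝ)}

/-- The random variable `exp(-q τ_n) f(Y_{τ_n})`, which is `0` where `τ_n = ∞`. -/
noncomputable def drawdownPayoff (M : MarkovChain G Ω) (a : ℝ) (f : S → ℂ) (n : ℕ) (q : ℂ)
    (ω : Ω) : ℂ :=
  if M.drawdownTime a n ω < ∞ then
    Complex.exp (-(q * ((M.drawdownTime a n ω).toReal : ℂ))) *
      f (M.Y (M.drawdownTime a n ω).toNNReal ω)
  else 0

/-- The quantity `H_n(q, x) = E_x[exp(-q τ_n) f(Y_{τ_n})]`. -/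
noncomputable def drawdownExpectation (M : MarkovChain G Ω) (a : ℝ) (f : S → ℂ) (n : ℕ) (q : ℂ)
    (x : S) : ℂ :=
  ∫ ω, M.drawdownPayoff a f n q ω ∂(M.P x)

end MarkovChain

namespace MarkovChain

open Filter Topology TopologicalSpace

variable {S : Finset ℝ} {G : Matrix S S ℝ} {Ω : Type*} [MeasurableSpace Ω]

/-! ### Pathwise description of the passage and drawdown times -/

/-! Let `T` be the exit time of the chain from `(x - a, x]`, started at `x`. Two values in this
interval differ by less than `a`, so no drawdown is completed before `T`. If the exit is downward,
the drop from `x` is at least `a`, so the first drawdown time is `T` and the later ones are those of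
the path after `T`, with index lowered by one. If it is upward, `Y_T` is a strict new maximum, the
past plays no further role, and every drawdown time of index at least one is `T` plus that of the
path after `T`. This gives a pathwise identity (`drawdownPayoff_succ_eq_sum`); taking expectations
and splitting by the value of `Y_T` gives the linear system.

The probabilistic input is the strong Markov property at `T` (`integral_payoffAt_passageTime_mul`).
The product form of the finite-dimensional laws gives the Markov property at fixed times, first for
cylinders, then for all path functionals. For `T`, the chain is observed on a grid, the Markov
property is applied at each possible grid exit, and the mesh tends to zero. The limit needs
functionals continuous under small time shifts; the drawdown payoffs are
(`tendsto_canonical_drawdownPayoff_shift`), because a right-continuous path in a finite set is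
constant for a short time after each instant. -/

lemma exists_constant_right (M : MarkovChain G Ω) (ω : Ω) (t : ℝ≥0) :
    ∃ δ : ℝ≥0, t < δ ∧ ∀ u, t ≤ u → u < δ → M.Y u ω = M.Y t ω := by
  have h := M.rightContinuous ω t
  rw [ContinuousWithinAt, nhds_discrete, tendsto_pure] at h
  obtain ⟨δ, hδ, hsub⟩ := (mem_nhdsGE_iff_exists_Ico_subset' (lt_add_one t)).1 h
  exact ⟨δ, hδ, fun u h1 h2 => hsub ⟨h1, h2⟩⟩

lemma exists_denseSeq_between {t c : ℝ≥0} (h : t < c) :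
    ∃ i, t < denseSeq ℝ≥0 i ∧ denseSeq ℝ≥0 i < c := by
  obtain ⟨_, ⟨i, rfl⟩, h1, h2⟩ := (denseRange_denseSeq ℝ≥0).exists_between h
  exact ⟨i, h1, h2⟩

lemma passageTime_lt_iff (M : MarkovChain G Ω) (A : Set ℝ) (ω : Ω) (c : ℝ≥0∞) :
    M.passageTime A ω < c ↔ ∃ t : ℝ≥0, 0 < t ∧ (t : ℝ≥0∞) < c ∧ (M.Y t ω : ℝ) ∉ A := by
  rw [passageTime, sInf_lt_iff]
  constructor
  · rintro ⟨_, ⟨t, rfl, h0, hA⟩, hc⟩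
    exact ⟨t, h0, hc, hA⟩
  · rintro ⟨t, h0, hc, hA⟩
    exact ⟨t, ⟨t, rfl, h0, hA⟩, hc⟩

lemma passageTime_le (M : MarkovChain G Ω) {A : Set ℝ} {ω : Ω} {t : ℝ≥0} (h0 : 0 < t)
    (hA : (M.Y t ω : ℝ) ∉ A) : M.passageTime A ω ≤ t :=
  sInf_le ⟨t, rfl, h0, hA⟩

/-- The infimum is approached by times outside `A`, and some of them fall in the interval of
constancy to the right of `T`. -/
lemma notMem_of_passageTime_eq (M : MarkovChain G Ω) {A : Set ℝ} {ω : Ω} {T : ℝ≥0}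
    (hT : M.passageTime A ω = T) : (M.Y T ω : ℝ) ∉ A := by
  obtain ⟨δ, hδ, hconst⟩ := M.exists_constant_right ω T
  obtain ⟨t, h0, htδ, hA⟩ := (M.passageTime_lt_iff A ω δ).1 (by rw [hT]; exact_mod_cast hδ)
  have hTt : T ≤ t := by
    have := M.passageTime_le h0 hA
    rw [hT] at this
    exact_mod_cast this
  rwa [hconst t hTt (by exact_mod_cast htδ)] at hA

lemma le_runningMax_sub_iff (M : MarkovChain G Ω) {a : ℝ} {s t : ℝ≥0} (hst : s ≤ t) (ω : Ω) :
    a ≤ M.runningMax s t ω - (M.Y t ω : ℝ) ↔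
      ∃ u, s ≤ u ∧ u ≤ t ∧ a ≤ (M.Y u ω : ℝ) - (M.Y t ω : ℝ) := by
  have hfin : ((fun u => (M.Y u ω : ℝ)) '' Set.Icc s t).Finite := by
    refine S.finite_toSet.subset ?_
    rintro _ ⟨u, -, rfl⟩
    exact (M.Y u ω).2
  have hne : ((fun u => (M.Y u ω : ℝ)) '' Set.Icc s t).Nonempty :=
    ⟨_, s, ⟨le_rfl, hst⟩, rfl⟩
  constructor
  · intro h
    obtain ⟨u, hu, hmax⟩ := hne.csSup_mem hfin
    refine ⟨u, hu.1, hu.2, ?_⟩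
    rw [runningMax, ← hmax] at h
    exact h
  · rintro ⟨u, h1, h2, h⟩
    have : (M.Y u ω : ℝ) ≤ M.runningMax s t ω := le_csSup hfin.bddAbove ⟨u, ⟨h1, h2⟩, rfl⟩
    linarith

/-- The supremum is attained because the state space is finite, and `0 < a` forces `u ≠ t`, which
turns the strict inequality with the previous time into a weak one at `u`. This form transfers to
dense times and to shifted paths. -/
lemma drawdownTime_succ_lt_iff (M : MarkovChain G Ω) {a : ℝ} (ha : 0 < a) (n : ℕ) (ω : Ω)
    (c : ℝ≥0∞) :
    M.drawdownTime a (n + 1) ω < c ↔ ∃ u t : ℝ≥0, u ≤ t ∧ M.drawdownTime a n ω ≤ u ∧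
      a ≤ (M.Y u ω : ℝ) - (M.Y t ω : ℝ) ∧ (t : ℝ≥0∞) < c := by
  rw [drawdownTime, sInf_lt_iff]
  constructor
  · rintro ⟨_, ⟨t, rfl, hlt, h⟩, hc⟩
    have hfin : M.drawdownTime a n ω ≠ ∞ := hlt.ne_top
    have hst : (M.drawdownTime a n ω).toNNReal ≤ t := by
      rw [← ENNReal.coe_le_coe, ENNReal.coe_toNNReal hfin]
      exact hlt.le
    obtain ⟨u, h1, h2, h3⟩ := (M.le_runningMax_sub_iff hst ω).1 h
    refine ⟨u, t, h2, ?_, h3, hc⟩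
    rwa [← ENNReal.coe_le_coe, ENNReal.coe_toNNReal hfin] at h1
  · rintro ⟨u, t, hut, hle, h, hc⟩
    have hne : u ≠ t := by
      rintro rfl
      linarith
    have hlt : M.drawdownTime a n ω < t :=
      hle.trans_lt (by exact_mod_cast lt_of_le_of_ne hut hne)
    have hfin : M.drawdownTime a n ω ≠ ∞ := hlt.ne_top
    have hsu : (M.drawdownTime a n ω).toNNReal ≤ u := by
      rwa [← ENNReal.coe_le_coe, ENNReal.coe_toNNReal hfin]
    exact ⟨t, ⟨t, rfl, hlt, (M.le_runningMax_sub_iff (hsu.trans hut) ω).2 ⟨u, hsu, hut, h⟩⟩, hc⟩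

/-! ### Measurability and integrability of the payoffs -/

lemma measurable_passageTime (M : MarkovChain G Ω) (A : Set ℝ) :
    Measurable (M.passageTime A) := by
  refine measurable_of_Iio fun c => ?_
  have : M.passageTime A ⁻¹' Set.Iio c = ⋃ i : ℕ, {ω |
      (0 < denseSeq ℝ≥0 i ∧ (denseSeq ℝ≥0 i : ℝ≥0∞) < c) ∧
        (M.Y (denseSeq ℝ≥0 i) ω : ℝ) ∉ A} := by
    ext ω
    simp only [Set.mem_preimage, Set.mem_Iio, Set.mem_iUnion, Set.mem_ofPred_eq]
    rw [passageTime_lt_iff]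
    constructor
    · rintro ⟨t, h0, hc, hA⟩
      obtain ⟨δ, hδ, hconst⟩ := M.exists_constant_right ω t
      obtain ⟨b, hb, hbc⟩ := ENNReal.lt_iff_exists_nnreal_btwn.1 hc
      obtain ⟨i, h1, h2⟩ := exists_denseSeq_between (lt_min hδ (by exact_mod_cast hb : t < b))
      refine ⟨i, ⟨h0.trans h1, lt_trans ?_ hbc⟩, ?_⟩
      · exact_mod_cast h2.trans_le (min_le_right _ _)
      · rwa [hconst _ h1.le (h2.trans_le (min_le_left _ _))]
    · rintro ⟨i, ⟨h0, hc⟩, hA⟩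
      exact ⟨_, h0, hc, hA⟩
  rw [this]
  refine MeasurableSet.iUnion fun i => (MeasurableSet.const _).inter ?_
  exact M.measurable_Y _ (Set.toFinite {z : S | (z : ℝ) ∉ A}).measurableSet

lemma measurable_drawdownTime (M : MarkovChain G Ω) {a : ℝ} (ha : 0 < a) (n : ℕ) :
    Measurable (M.drawdownTime a n) := by
  induction n with
  | zero => exact measurable_const
  | succ n ih =>
    refine measurable_of_Iio fun c => ?_
    have : M.drawdownTime a (n + 1) ⁻¹' Set.Iio c = ⋃ (i : ℕ) (j : ℕ),
        {ω | (denseSeq ℝ≥0 i ≤ denseSeq ℝ≥0 j ∧ (denseSeq ℝ≥0 j : ℝ≥0∞) < c) ∧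
          M.drawdownTime a n ω ≤ denseSeq ℝ≥0 i ∧
          a ≤ (M.Y (denseSeq ℝ≥0 i) ω : ℝ) - (M.Y (denseSeq ℝ≥0 j) ω : ℝ)} := by
      ext ω
      simp only [Set.mem_preimage, Set.mem_Iio, Set.mem_iUnion, Set.mem_ofPred_eq]
      rw [M.drawdownTime_succ_lt_iff ha]
      constructor
      · rintro ⟨u, t, hut, hle, h, hc⟩
        obtain ⟨δ, hδ, hconst⟩ := M.exists_constant_right ω t
        obtain ⟨ε, hε, hconst'⟩ := M.exists_constant_right ω u
        obtain ⟨b, hb, hbc⟩ := ENNReal.lt_iff_exists_nnreal_btwn.1 hc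
        obtain ⟨j, h1, h2⟩ := exists_denseSeq_between (lt_min hδ (by exact_mod_cast hb : t < b))
        -- The later time is moved first, strictly past `u`, which leaves room to move `u` without
        -- breaking the order.
        obtain ⟨i, h3, h4⟩ := exists_denseSeq_between (lt_min hε (hut.trans_lt h1))
        refine ⟨i, j, ⟨(h4.trans_le (min_le_right _ _)).le, lt_trans ?_ hbc⟩,
          hle.trans (by exact_mod_cast h3.le), ?_⟩
        · exact_mod_cast h2.trans_le (min_le_right _ _)
        · rwa [hconst _ h1.le (h2.trans_le (min_le_left _ _)),
            hconst' _ h3.le (h4.trans_le (min_le_left _ _))]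
      · rintro ⟨i, j, ⟨h1, h2⟩, h3, h4⟩
        exact ⟨_, _, h1, h3, h4, h2⟩
    rw [this]
    have hY : ∀ t, Measurable fun ω => (M.Y t ω : ℝ) := fun t =>
      measurable_subtype_coe.comp (M.measurable_Y t)
    refine MeasurableSet.iUnion fun i => MeasurableSet.iUnion fun j =>
      (MeasurableSet.const _).inter ((measurableSet_le ih measurable_const).inter ?_)
    exact measurableSet_le measurable_const ((hY _).sub (hY _))

/-- Approximate `σ` strictly from the right by grid points: these take countably many values, and
right-constancy makes the approximating states eventually equal to the limit. -/
lemma measurable_comp_time (M : MarkovChain G Ω) {σ : Ω → ℝ≥0} (hσ : Measurable σ) :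
    Measurable fun ω => M.Y (σ ω) ω := by
  have hcomp : ∀ (g : ℕ → ℝ≥0) (N : Ω → ℕ), Measurable N → Measurable fun ω => M.Y (g (N ω)) ω :=
    fun g N hN => (measurable_from_prod_countable_right (f := fun p : ℕ × Ω => M.Y (g p.1) p.2)
      fun n => M.measurable_Y (g n)).comp (hN.prodMk measurable_id)
  have hmeas : ∀ k : ℕ, Measurable fun ω =>
      M.Y (((⌊((k : ℝ≥0) + 1) * σ ω⌋₊ : ℝ≥0) + 1) / ((k : ℝ≥0) + 1)) ω := fun k =>
    hcomp (fun n => ((n : ℝ≥0) + 1) / ((k : ℝ≥0) + 1)) _ (measurable_const.mul hσ).nat_floor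
  refine measurable_of_tendsto_metrizable hmeas (tendsto_pi_nhds.2 fun ω => ?_)
  refine tendsto_const_nhds.congr' ?_
  obtain ⟨δ, hδ, hconst⟩ := M.exists_constant_right ω (σ ω)
  obtain ⟨N, hN⟩ := exists_nat_gt (1 / (δ - σ ω))
  filter_upwards [eventually_ge_atTop N] with k hk
  have hpos : (0 : ℝ≥0) < (k : ℝ≥0) + 1 := by positivity
  have hd : 0 < δ - σ ω := tsub_pos_of_lt hδ
  refine (hconst _ ?_ ?_).symm
  · rw [le_div_iff₀ hpos, mul_comm]
    exact (Nat.lt_floor_add_one _).le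
  · rw [div_lt_iff₀ hpos]
    have h1 : (⌊((k : ℝ≥0) + 1) * σ ω⌋₊ : ℝ≥0) ≤ ((k : ℝ≥0) + 1) * σ ω :=
      Nat.floor_le (by positivity)
    have h2 : 1 < (δ - σ ω) * ((k : ℝ≥0) + 1) := by
      rw [div_lt_iff₀ hd, mul_comm] at hN
      refine hN.trans_le (mul_le_mul_right (le_trans ?_ (le_add_of_nonneg_right zero_le_one)) _)
      exact_mod_cast hk
    calc (⌊((k : ℝ≥0) + 1) * σ ω⌋₊ : ℝ≥0) + 1
        < ((k : ℝ≥0) + 1) * σ ω + (δ - σ ω) * ((k : ℝ≥0) + 1) := add_lt_add_of_le_of_lt h1 h2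
      _ = (σ ω + (δ - σ ω)) * ((k : ℝ≥0) + 1) := by ring
      _ = δ * ((k : ℝ≥0) + 1) := by rw [add_tsub_cancel_of_le hδ.le]

/-- The payoff `exp(-q σ) g(Y_σ)` at a random time `σ`, which is `0` where `σ = ∞`. -/
noncomputable def payoffAt (M : MarkovChain G Ω) (σ : Ω → ℝ≥0∞) (q : ℂ) (g : S → ℂ)
    (ω : Ω) : ℂ :=
  if σ ω < ∞ then Complex.exp (-(q * ((σ ω).toReal : ℂ))) * g (M.Y (σ ω).toNNReal ω) else 0

lemma drawdownPayoff_eq (M : MarkovChain G Ω) (a : ℝ) (f : S → ℂ) (n : ℕ) (q : ℂ) :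
    M.drawdownPayoff a f n q = M.payoffAt (M.drawdownTime a n) q f := rfl

lemma passagePayoff_const (M : MarkovChain G Ω) (A : Set ℝ) (q : ℂ) (g : S → ℂ) :
    M.passagePayoff A (fun _ => q) g = M.payoffAt (M.passageTime A) q g := by
  funext ω
  simp [passagePayoff, payoffAt, mul_comm]

lemma measurable_payoffAt (M : MarkovChain G Ω) {σ : Ω → ℝ≥0∞} (hσ : Measurable σ) (q : ℂ)
    (g : S → ℂ) : Measurable (M.payoffAt σ q g) := by
  refine Measurable.ite (measurableSet_lt hσ measurable_const) ?_ measurable_const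
  refine Measurable.mul ?_ ?_
  · exact Complex.measurable_exp.comp
      ((measurable_const.mul (Complex.measurable_ofReal.comp hσ.ennreal_toReal)).neg)
  · exact (measurable_of_finite g).comp (M.measurable_comp_time hσ.ennreal_toNNReal)

lemma norm_exp_neg_mul_le_one {q : ℂ} (hq : 0 < q.re) {t : ℝ} (ht : 0 ≤ t) :
    ‖Complex.exp (-(q * (t : ℂ)))‖ ≤ 1 := by
  rw [Complex.norm_exp, Real.exp_le_one_iff]
  simp only [Complex.neg_re, Complex.re_mul_ofReal]
  nlinarith

lemma norm_payoffAt_le (M : MarkovChain G Ω) (σ : Ω → ℝ≥0∞) {q : ℂ} (hq : 0 < q.re)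
    (g : S → ℂ) (ω : Ω) : ‖M.payoffAt σ q g ω‖ ≤ ∑ z, ‖g z‖ := by
  rw [payoffAt]
  split_ifs with h
  · rw [norm_mul]
    calc _ ≤ 1 * ‖g (M.Y (σ ω).toNNReal ω)‖ := by
          gcongr
          exact norm_exp_neg_mul_le_one hq ENNReal.toReal_nonneg
      _ = ‖g (M.Y (σ ω).toNNReal ω)‖ := one_mul _
      _ ≤ _ := Finset.single_le_sum (f := fun z => ‖g z‖) (fun z _ => norm_nonneg _)
          (Finset.mem_univ _)
  · rw [norm_zero]
    positivity

lemma integrable_payoffAt (M : MarkovChain G Ω) {σ : Ω → ℝ≥0∞} (hσ : Measurable σ) {q : ℂ}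
    (hq : 0 < q.re) (g : S → ℂ) (μ : Measure Ω) [IsFiniteMeasure μ] :
    Integrable (M.payoffAt σ q g) μ :=
  Integrable.of_bound (M.measurable_payoffAt hσ q g).aestronglyMeasurable _
    (ae_of_all _ (M.norm_payoffAt_le σ hq g))

end MarkovChain

/-! ### The space of right-continuous paths -/

/-- The right-continuous paths in `S`, with the `σ`-algebra generated by the coordinates. -/
abbrev RightContinuousPath (S : Finset ℝ) : Type :=
  {w : ℝ≥0 → S // ∀ t, ContinuousWithinAt w (Set.Ici t) t}

namespace RightContinuousPath

variable {S : Finset ℝ}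

/-- The path `w (s + ·)`. -/
def shift (s : ℝ≥0) (w : RightContinuousPath S) : RightContinuousPath S :=
  ⟨fun t => w.1 (s + t), fun t => (w.2 (s + t)).comp (by fun_prop)
    fun _ hu => add_le_add_right hu s⟩

/-- The paths through `z 0, …, z m` at the times `t 0, …, t m`. -/
def pathCylinder (m : ℕ) (t : ℕ → ℝ≥0) (z : ℕ → S) : Set (RightContinuousPath S) :=
  {w | ∀ i ≤ m, w.1 (t i) = z i}

lemma measurable_coord (t : ℝ≥0) : Measurable fun w : RightContinuousPath S => w.1 t :=
  (measurable_pi_apply t).comp measurable_subtype_coe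

lemma measurableSet_pathCylinder (m : ℕ) (t : ℕ → ℝ≥0) (z : ℕ → S) :
    MeasurableSet (pathCylinder m t z) := by
  have : pathCylinder m t z = ⋂ i ∈ Set.Iic m, {w | w.1 (t i) = z i} := by
    ext w
    simp [pathCylinder]
  rw [this]
  exact MeasurableSet.biInter (Set.to_countable _) fun i _ =>
    measurable_coord (t i) (measurableSet_singleton (z i))

/-- List `J` in increasing order, capping the index at the last element so that the list is a
monotone sequence on all of `ℕ`. -/
lemma exists_pathCylinder_eq (J : Finset ℝ≥0) (hJ : 0 ∈ J) (z : J → S) :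
    ∃ (m : ℕ) (t : ℕ → ℝ≥0) (z' : ℕ → S), Monotone t ∧ t 0 = 0 ∧
      (fun w : RightContinuousPath S => J.restrict w.1) ⁻¹' {z} = pathCylinder m t z' := by
  have hpos : 0 < J.card := Finset.card_pos.2 ⟨0, hJ⟩
  let idx : ℕ → Fin J.card := fun i => ⟨min i (J.card - 1), by omega⟩
  let t : ℕ → ℝ≥0 := fun i => J.orderEmbOfFin rfl (idx i)
  have htJ : ∀ i, t i ∈ J := fun i => J.orderEmbOfFin_mem rfl _
  refine ⟨J.card - 1, t, fun i => z ⟨t i, htJ i⟩, fun i j hij => ?_, ?_, ?_⟩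
  · refine (J.orderEmbOfFin rfl).monotone ?_
    simp only [idx, Fin.mk_le_mk]
    omega
  · have : t 0 = J.min' ⟨0, hJ⟩ := by
      rw [← J.orderEmbOfFin_zero rfl hpos]
      simp [t, idx]
    exact le_antisymm (this.trans_le (J.min'_le 0 hJ)) zero_le
  · ext w
    simp only [Set.mem_preimage, Set.mem_singleton_iff, pathCylinder, Set.mem_ofPred_eq]
    constructor
    · rintro rfl i -
      rfl
    · intro h
      funext s
      obtain ⟨i, hi⟩ : (s : ℝ≥0) ∈ Set.range (J.orderEmbOfFin rfl) := by
        rw [J.range_orderEmbOfFin rfl]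
        exact s.2
      have hti : t i = s := by
        rw [← hi]
        have : idx i = i := Fin.ext (min_eq_left (by omega))
        simp only [t, this]
      have := h i (by omega)
      have hs : s = ⟨t i, htJ i⟩ := Subtype.ext hti.symm
      rw [hs]
      exact this

/-- A finite measure on the product space is determined by its finite-dimensional marginals.
Cylinders fix only marginals over time sets containing `0`; the others are projections of these. -/
lemma measure_ext {μ ν : Measure (RightContinuousPath S)} [IsFiniteMeasure μ] [IsFiniteMeasure ν]
    (h : ∀ (m : ℕ) (t : ℕ → ℝ≥0) (z : ℕ → S), Monotone t → t 0 = 0 →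
      μ (pathCylinder m t z) = ν (pathCylinder m t z)) : μ = ν := by
  have hval : Measurable (Subtype.val : RightContinuousPath S → ℝ≥0 → S) := measurable_subtype_coe
  have key : ∀ J : Finset ℝ≥0, 0 ∈ J →
      (μ.map Subtype.val).map J.restrict = (ν.map Subtype.val).map J.restrict := by
    intro J hJ
    rw [Measure.map_map (Finset.measurable_restrict J) hval,
      Measure.map_map (Finset.measurable_restrict J) hval]
    refine Measure.ext_of_singleton fun z => ?_
    obtain ⟨m, t, z', ht, ht0, heq⟩ := exists_pathCylinder_eq J hJ z
    rw [Measure.map_apply ((Finset.measurable_restrict J).comp hval) (measurableSet_singleton z),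
      Measure.map_apply ((Finset.measurable_restrict J).comp hval) (measurableSet_singleton z)]
    exact heq ▸ h m t z' ht ht0
  have hmap : μ.map Subtype.val = ν.map Subtype.val := by
    refine IsProjectiveLimit.unique (P := fun I => (ν.map Subtype.val).map I.restrict)
      (fun I => ?_) fun I => rfl
    have hI : I ⊆ insert 0 I := Finset.subset_insert 0 I
    rw [← Finset.restrict₂_comp_restrict hI,
      ← Measure.map_map (Finset.measurable_restrict₂ hI) (Finset.measurable_restrict _),
      key _ (Finset.mem_insert_self 0 I),
      Measure.map_map (Finset.measurable_restrict₂ hI) (Finset.measurable_restrict _),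
      Finset.restrict₂_comp_restrict]
  ext s hs
  obtain ⟨s', hs', rfl⟩ := hs
  rw [← Measure.map_apply hval hs', hmap, Measure.map_apply hval hs']

end RightContinuousPath

/-! ### Transfer of the chain to path space -/

namespace MarkovChain

open Filter Topology RightContinuousPath

variable {S : Finset ℝ} {G : Matrix S S ℝ} {Ω : Type*} [MeasurableSpace Ω]

instance (M : MarkovChain G Ω) (x : S) : IsProbabilityMeasure (M.P x) := M.isProbabilityMeasure x

/-- The sample path after time `s`. -/
def pathFrom (M : MarkovChain G Ω) (s : ℝ≥0) (ω : Ω) : RightContinuousPath S :=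
  shift s ⟨fun t => M.Y t ω, M.rightContinuous ω⟩

lemma measurable_pathFrom (M : MarkovChain G Ω) (s : ℝ≥0) : Measurable (M.pathFrom s) :=
  (measurable_pi_lambda _ fun t => M.measurable_Y (s + t)).subtype_mk

lemma shift_pathFrom (M : MarkovChain G Ω) (s r : ℝ≥0) (ω : Ω) :
    shift r (M.pathFrom s ω) = M.pathFrom (s + r) ω :=
  Subtype.ext (funext fun t => congrArg (M.Y · ω) (add_assoc s r t).symm)

lemma preimage_pathFrom_zero_pathCylinder (M : MarkovChain G Ω) (m : ℕ) (t : ℕ → ℝ≥0) (z : ℕ → S) :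
    M.pathFrom 0 ⁻¹' pathCylinder m t z = {ω | ∀ i ≤ m, M.Y (t i) ω = z i} := by
  ext ω
  simp [pathFrom, pathCylinder, shift]

/-- The coordinate process on path space under the laws of the chain `M`. -/
noncomputable def canonical (M : MarkovChain G Ω) : MarkovChain G (RightContinuousPath S) where
  P x := (M.P x).map (M.pathFrom 0)
  isProbabilityMeasure x :=
    Measure.isProbabilityMeasure_map (M.measurable_pathFrom 0).aemeasurable
  Y t w := w.1 t
  measurable_Y := measurable_coord
  rightContinuous w := w.2
  finiteDimensional x m t z ht ht0 hz := by
    rw [← M.finiteDimensional x m t z ht ht0 hz, ← preimage_pathFrom_zero_pathCylinder]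
    exact map_measureReal_apply (M.measurable_pathFrom 0) (measurableSet_pathCylinder m t z)

/-! ### The Markov property -/

lemma ae_Y_zero (M : MarkovChain G Ω) (x : S) : ∀ᵐ ω ∂(M.P x), M.Y 0 ω = x := by
  have h := M.finiteDimensional x 0 (fun _ => 0) (fun _ => x) monotone_const rfl rfl
  rw [Finset.prod_range_zero] at h
  have hs : {ω | ∀ i ≤ 0, M.Y ((fun _ : ℕ => (0 : ℝ≥0)) i) ω = (fun _ : ℕ => x) i} =
      M.Y 0 ⁻¹' {x} := by
    ext ω
    simp
  rw [hs] at h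
  refine (mem_ae_iff_prob_eq_one (M.measurable_Y 0 (measurableSet_singleton x))).2 ?_
  rw [← ENNReal.toReal_eq_one_iff]
  exact h

lemma measurableSet_cylinder_Y (M : MarkovChain G Ω) (m : ℕ) (t : ℕ → ℝ≥0) (z : ℕ → S) :
    MeasurableSet {ω | ∀ i ≤ m, M.Y (t i) ω = z i} := by
  rw [← preimage_pathFrom_zero_pathCylinder]
  exact M.measurable_pathFrom 0 (measurableSet_pathCylinder m t z)

/-- Concatenating the two lists of times gives a single cylinder, whose product of transition
probabilities splits at index `m`; the offset `t m` cancels in the increments. Mismatched endpoints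
make both sides zero. -/
lemma measureReal_cylinder_inter (M : MarkovChain G Ω) (x : S) (m l : ℕ) (t s : ℕ → ℝ≥0)
    (z v : ℕ → S) (ht : Monotone t) (ht0 : t 0 = 0) (hs : Monotone s) (hs0 : s 0 = 0) :
    (M.P x).real (M.pathFrom (t m) ⁻¹' pathCylinder l s v ∩ {ω | ∀ i ≤ m, M.Y (t i) ω = z i}) =
      (M.P x).real {ω | ∀ i ≤ m, M.Y (t i) ω = z i} *
        (M.P (z m)).real {ω | ∀ i ≤ l, M.Y (s i) ω = v i} := by
  have hnull : ∀ (x : S) (m : ℕ) (t : ℕ → ℝ≥0) (z : ℕ → S), t 0 = 0 → z 0 ≠ x →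
      (M.P x).real {ω | ∀ i ≤ m, M.Y (t i) ω = z i} = 0 := fun x m t z ht0 hz => by
    rw [measureReal_def, ENNReal.toReal_eq_zero_iff]
    left
    refine measure_mono_null ?_ (ae_iff.1 (M.ae_Y_zero x))
    intro ω hω h
    have := hω 0 (Nat.zero_le m)
    rw [ht0] at this
    exact hz (this.symm.trans h)
  by_cases hz : z 0 = x
  swap
  · rw [hnull x m t z ht0 hz, zero_mul]
    refine le_antisymm ?_ measureReal_nonneg
    rw [← hnull x m t z ht0 hz]
    exact measureReal_mono Set.inter_subset_right
  by_cases hv : v 0 = z m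
  swap
  · rw [hnull (z m) l s v hs0 hv, mul_zero]
    have : M.pathFrom (t m) ⁻¹' pathCylinder l s v ∩ {ω | ∀ i ≤ m, M.Y (t i) ω = z i} = ∅ := by
      refine Set.eq_empty_of_forall_notMem fun ω hω => hv ?_
      have h1 : M.Y (t m + s 0) ω = v 0 := hω.1 0 (Nat.zero_le l)
      rw [hs0, add_zero] at h1
      exact h1.symm.trans (hω.2 m le_rfl)
    rw [this, measureReal_empty]
  let T : ℕ → ℝ≥0 := fun i => if i ≤ m then t i else t m + s (i - m)
  let Z : ℕ → S := fun i => if i ≤ m then z i else v (i - m)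
  have hTm : ∀ i, T (m + i) = t m + s i := fun i => by
    rcases Nat.eq_zero_or_pos i with rfl | hi
    · simp [T, hs0]
    · simp only [T, if_neg (by omega : ¬ m + i ≤ m), Nat.add_sub_cancel_left]
  have hZm : ∀ i, Z (m + i) = v i := fun i => by
    rcases Nat.eq_zero_or_pos i with rfl | hi
    · simp [Z, hv]
    · simp only [Z, if_neg (by omega : ¬ m + i ≤ m), Nat.add_sub_cancel_left]
  have hTl : ∀ i ≤ m, T i = t i := fun i hi => if_pos hi
  have hZl : ∀ i ≤ m, Z i = z i := fun i hi => if_pos hi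
  have hT : Monotone T := by
    refine monotone_nat_of_le_succ fun i => ?_
    rcases lt_or_ge i m with hi | hi
    · rw [hTl i hi.le, hTl (i + 1) hi]
      exact ht (Nat.le_succ i)
    · obtain ⟨j, rfl⟩ := Nat.exists_eq_add_of_le hi
      rw [add_assoc, hTm, hTm]
      exact add_le_add_right (hs (Nat.le_succ j)) _
  have hset : M.pathFrom (t m) ⁻¹' pathCylinder l s v ∩ {ω | ∀ i ≤ m, M.Y (t i) ω = z i} =
      {ω | ∀ i ≤ m + l, M.Y (T i) ω = Z i} := by
    ext ω
    constructor
    · rintro ⟨h1, h2⟩ i hi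
      rcases le_total i m with him | him
      · rw [hTl i him, hZl i him]
        exact h2 i him
      · obtain ⟨j, rfl⟩ := Nat.exists_eq_add_of_le him
        rw [hTm, hZm]
        exact h1 j (by omega)
    · intro h
      refine ⟨fun j hj => ?_, fun i hi => ?_⟩
      · have := h (m + j) (by omega)
        rw [hTm, hZm] at this
        exact this
      · have := h i (by omega)
        rwa [hTl i hi, hZl i hi] at this
  rw [hset, M.finiteDimensional x (m + l) T Z hT ((hTl 0 (Nat.zero_le m)).trans ht0)
      ((hZl 0 (Nat.zero_le m)).trans hz), M.finiteDimensional x m t z ht ht0 hz,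
    M.finiteDimensional (z m) l s v hs hs0 hv, Finset.prod_range_add]
  congr 1
  · refine Finset.prod_congr rfl fun i hi => ?_
    have hi := Finset.mem_range.1 hi
    rw [hTl i hi.le, hTl (i + 1) hi, hZl i hi.le, hZl (i + 1) hi]
  · refine Finset.prod_congr rfl fun i _ => ?_
    rw [add_assoc, hTm, hTm, hZm, hZm, NNReal.coe_add, NNReal.coe_add, add_sub_add_left_eq_sub]

lemma map_pathFrom_restrict_cylinder (M : MarkovChain G Ω) (x : S) (m : ℕ) (t : ℕ → ℝ≥0)
    (z : ℕ → S) (ht : Monotone t) (ht0 : t 0 = 0) :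
    ((M.P x).restrict {ω | ∀ i ≤ m, M.Y (t i) ω = z i}).map (M.pathFrom (t m)) =
      (M.P x) {ω | ∀ i ≤ m, M.Y (t i) ω = z i} • (M.canonical.P (z m)) := by
  have : IsFiniteMeasure ((M.P x) {ω | ∀ i ≤ m, M.Y (t i) ω = z i} • (M.canonical.P (z m))) :=
    Measure.smul_finite _ (measure_ne_top _ _)
  refine measure_ext fun l s v hs hs0 => ?_
  rw [Measure.map_apply (M.measurable_pathFrom _) (measurableSet_pathCylinder l s v),
    Measure.restrict_apply (M.measurable_pathFrom _ (measurableSet_pathCylinder l s v)),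
    Measure.smul_apply, smul_eq_mul, canonical,
    Measure.map_apply (M.measurable_pathFrom _) (measurableSet_pathCylinder l s v),
    preimage_pathFrom_zero_pathCylinder, ← ENNReal.toReal_eq_toReal_iff' (measure_ne_top _ _)
      (ENNReal.mul_ne_top (measure_ne_top _ _) (measure_ne_top _ _)), ENNReal.toReal_mul]
  exact M.measureReal_cylinder_inter x m l t s z v ht ht0 hs hs0

/-- The Markov property at the time `t m`, for an event that depends on `Y` at `t 0, …, t m`. -/
lemma setIntegral_comp_pathFrom (M : MarkovChain G Ω) (x y : S) (m : ℕ) (t : ℕ → ℝ≥0)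
    (ht : Monotone t) (ht0 : t 0 = 0) (C : Set (Fin (m + 1) → S))
    (hC : ∀ z ∈ C, z (Fin.last m) = y) {F : RightContinuousPath S → ℂ} (hF : Measurable F)
    {B : ℝ} (hB : ∀ w, ‖F w‖ ≤ B) :
    ∫ ω in {ω | (fun i : Fin (m + 1) => M.Y (t i) ω) ∈ C}, F (M.pathFrom (t m) ω) ∂(M.P x) =
      (M.P x).real {ω | (fun i : Fin (m + 1) => M.Y (t i) ω) ∈ C} *
        ∫ w, F w ∂(M.canonical.P y) := by
  classical
  have hext : ∀ z : Fin (m + 1) → S, {ω | (fun i : Fin (m + 1) => M.Y (t i) ω) = z} =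
      {ω | ∀ i ≤ m, M.Y (t i) ω = (fun i : ℕ => z ⟨min i m, by omega⟩) i} := fun z => by
    ext ω
    constructor
    · rintro rfl i hi
      simp [min_eq_left hi]
    · intro h
      funext i
      have hi : (i : ℕ) ≤ m := Nat.lt_succ_iff.1 i.2
      exact (h i hi).trans (congrArg z (Fin.ext (min_eq_left hi)))
  have hmeas : ∀ z : Fin (m + 1) → S,
      MeasurableSet {ω | (fun i : Fin (m + 1) => M.Y (t i) ω) = z} := fun z => by
    rw [hext]
    exact M.measurableSet_cylinder_Y m t _
  -- The event splits into finitely many exact histories, all ending in `y`, so each contributes the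
  -- same factor.
  have hdisj : Pairwise (Function.onFun Disjoint
      fun z : Fin (m + 1) → S => {ω | (fun i : Fin (m + 1) => M.Y (t i) ω) = z}) :=
    fun z z' hne => Set.disjoint_left.2 fun ω h h' => hne (Eq.trans (Eq.symm h) h')
  have hunion : {ω | (fun i : Fin (m + 1) => M.Y (t i) ω) ∈ C} =
      ⋃ z ∈ Finset.univ.filter (· ∈ C), {ω | (fun i : Fin (m + 1) => M.Y (t i) ω) = z} := by
    ext ω
    simp
  have hint : Integrable (fun ω => F (M.pathFrom (t m) ω)) (M.P x) :=
    Integrable.of_bound (hF.comp (M.measurable_pathFrom _)).aestronglyMeasurable B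
      (ae_of_all _ fun ω => hB _)
  rw [hunion, integral_biUnion_finset _ (fun z _ => hmeas z) (hdisj.set_pairwise _)
      (fun z _ => hint.integrableOn),
    measureReal_biUnion_finset (hdisj.set_pairwise _) (fun z _ => hmeas z), Complex.ofReal_sum,
    Finset.sum_mul]
  refine Finset.sum_congr rfl fun z hz => ?_
  have hlast : z ⟨min m m, by omega⟩ = y := by
    rw [← hC z (Finset.mem_filter.1 hz).2]
    exact congrArg z (Fin.ext (min_self m))
  have h := M.map_pathFrom_restrict_cylinder x m t (fun i : ℕ => z ⟨min i m, by omega⟩) ht ht0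
  rw [← hext z] at h
  simp only [hlast] at h
  rw [← integral_map (M.measurable_pathFrom _).aemeasurable hF.aestronglyMeasurable, h,
    integral_smul_measure, ← measureReal_def, Complex.real_smul]

end MarkovChain

namespace MarkovChain

open Filter Topology RightContinuousPath

variable {S : Finset ℝ} {G : Matrix S S ℝ} {Ω : Type*} [MeasurableSpace Ω]

/-! ### The strong Markov property at a passage time -/

/-- The `i`-th point of the grid with mesh `1 / (k + 1)`. -/
noncomputable def gridTime (k i : ℕ) : ℝ≥0 := (i : ℝ≥0) / ((k : ℝ≥0) + 1)

lemma gridTime_monotone (k : ℕ) : Monotone (gridTime k) := fun i j hij => by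
  unfold gridTime
  gcongr

lemma gridTime_succ_pos (k i : ℕ) : 0 < gridTime k (i + 1) := by
  unfold gridTime
  positivity

/-- The event that `j + 1` is the first positive index at which the chain, observed on the grid
with mesh `1 / (k + 1)`, lies outside `A`, and that it is then in the state `y`. -/
def gridExit (M : MarkovChain G Ω) (A : Set ℝ) (y : S) (k j : ℕ) : Set Ω :=
  {ω | M.Y (gridTime k (j + 1)) ω = y ∧ (y : ℝ) ∉ A ∧
    ∀ i < j, (M.Y (gridTime k (i + 1)) ω : ℝ) ∈ A}

/-- This exhibits the event as depending only on the grid observations up to the exit, as the Markov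
property requires. -/
lemma gridExit_eq (M : MarkovChain G Ω) (A : Set ℝ) (y : S) (k j : ℕ) :
    M.gridExit A y k j = {ω | (fun i : Fin (j + 1 + 1) => M.Y (gridTime k i) ω) ∈
      {z : Fin (j + 1 + 1) → S | z (Fin.last (j + 1)) = y ∧ (y : ℝ) ∉ A ∧
        ∀ i : Fin (j + 1 + 1), 1 ≤ (i : ℕ) → (i : ℕ) ≤ j → (z i : ℝ) ∈ A}} := by
  ext ω
  simp only [gridExit, Set.mem_ofPred_eq, Fin.val_last]
  refine and_congr_right fun _ => and_congr_right fun _ => ⟨fun h i h1 h2 => ?_, fun h i hi => ?_⟩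
  · have := h ((i : ℕ) - 1) (by omega)
    rwa [Nat.sub_add_cancel h1] at this
  · exact h ⟨i + 1, by omega⟩ (Nat.le_add_left 1 i) hi

lemma measurableSet_gridExit (M : MarkovChain G Ω) (A : Set ℝ) (y : S) (k j : ℕ) :
    MeasurableSet (M.gridExit A y k j) := by
  rw [gridExit_eq]
  exact (measurable_pi_lambda _ fun i : Fin (j + 1 + 1) => M.measurable_Y (gridTime k i))
    (Set.toFinite _).measurableSet

lemma eq_of_mem_gridExit (M : MarkovChain G Ω) {A : Set ℝ} {y : S} {k i j : ℕ} {ω : Ω}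
    (hi : ω ∈ M.gridExit A y k i) (hj : ω ∈ M.gridExit A y k j) : i = j := by
  rcases lt_trichotomy i j with h | h | h
  · exact absurd (hi.1 ▸ hj.2.2 i h) hi.2.1
  · exact h
  · exact absurd (hj.1 ▸ hi.2.2 j h) hj.2.1

/-- The payoff `exp(-q T) 1_{Y_T = y} F(Y_{T + ·})`, where `T` is the first passage time of the
chain observed at finitely many points of the grid with mesh `1 / (k + 1)`. -/
noncomputable def gridPayoff (M : MarkovChain G Ω) (A : Set ℝ) (q : ℂ) (y : S)
    (F : RightContinuousPath S → ℂ) (k : ℕ) (ω : Ω) : ℂ :=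
  ∑ j ∈ Finset.range ((k + 1) ^ 2), (M.gridExit A y k j).indicator (fun ω =>
    Complex.exp (-(q * ((gridTime k (j + 1) : ℝ) : ℂ))) *
      F (M.pathFrom (gridTime k (j + 1)) ω)) ω

lemma gridPayoff_eq_of_mem (M : MarkovChain G Ω) {A : Set ℝ} {q : ℂ} {y : S}
    (F : RightContinuousPath S → ℂ) {k j : ℕ} {ω : Ω} (hj : j < (k + 1) ^ 2)
    (hω : ω ∈ M.gridExit A y k j) :
    M.gridPayoff A q y F k ω = Complex.exp (-(q * ((gridTime k (j + 1) : ℝ) : ℂ))) *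
      F (M.pathFrom (gridTime k (j + 1)) ω) := by
  rw [gridPayoff, Finset.sum_eq_single j, Set.indicator_of_mem hω]
  · intro i _ hij
    exact Set.indicator_of_notMem (fun hi => hij (M.eq_of_mem_gridExit hi hω)) _
  · exact fun h => absurd (Finset.mem_range.2 hj) h

lemma gridPayoff_eq_zero (M : MarkovChain G Ω) {A : Set ℝ} {q : ℂ} {y : S}
    (F : RightContinuousPath S → ℂ) {k : ℕ} {ω : Ω}
    (hω : ∀ j < (k + 1) ^ 2, ω ∉ M.gridExit A y k j) : M.gridPayoff A q y F k ω = 0 :=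
  Finset.sum_eq_zero fun j hj => Set.indicator_of_notMem (hω j (Finset.mem_range.1 hj)) _

lemma norm_gridPayoff_le (M : MarkovChain G Ω) (A : Set ℝ) {q : ℂ} (hq : 0 < q.re) (y : S)
    {F : RightContinuousPath S → ℂ} {B : ℝ} (hB : ∀ w, ‖F w‖ ≤ B) (k : ℕ) (ω : Ω) :
    ‖M.gridPayoff A q y F k ω‖ ≤ B := by
  have hB0 : 0 ≤ B := (norm_nonneg _).trans (hB (M.pathFrom 0 ω))
  by_cases h : ∃ j < (k + 1) ^ 2, ω ∈ M.gridExit A y k j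
  · obtain ⟨j, hj, hω⟩ := h
    rw [M.gridPayoff_eq_of_mem F hj hω, norm_mul]
    calc _ ≤ 1 * B := mul_le_mul (norm_exp_neg_mul_le_one hq (NNReal.coe_nonneg _)) (hB _)
          (norm_nonneg _) zero_le_one
      _ = B := one_mul B
  · push Not at h
    rwa [M.gridPayoff_eq_zero F h, norm_zero]

lemma measurable_gridPayoff (M : MarkovChain G Ω) (A : Set ℝ) (q : ℂ) (y : S)
    {F : RightContinuousPath S → ℂ} (hF : Measurable F) (k : ℕ) :
    Measurable (M.gridPayoff A q y F k) :=
  Finset.measurable_fun_sum _ fun j _ =>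
    (measurable_const.mul (hF.comp (M.measurable_pathFrom _))).indicator
      (M.measurableSet_gridExit A y k j)

/-- The Markov property is applied at each grid exit. The scalar sum does not involve `F`, which is
what later allows it to be identified by taking `F = 1`. -/
lemma integral_gridPayoff (M : MarkovChain G Ω) (A : Set ℝ) (q : ℂ) (x y : S)
    {F : RightContinuousPath S → ℂ} (hF : Measurable F) {B : ℝ} (hB : ∀ w, ‖F w‖ ≤ B) (k : ℕ) :
    ∫ ω, M.gridPayoff A q y F k ω ∂(M.P x) =
      (∑ j ∈ Finset.range ((k + 1) ^ 2), Complex.exp (-(q * ((gridTime k (j + 1) : ℝ) : ℂ))) *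
        (M.P x).real (M.gridExit A y k j)) * ∫ w, F w ∂(M.canonical.P y) := by
  have hint : ∀ s, Integrable (fun ω => F (M.pathFrom s ω)) (M.P x) := fun s =>
    Integrable.of_bound (hF.comp (M.measurable_pathFrom _)).aestronglyMeasurable B
      (ae_of_all _ fun ω => hB _)
  unfold gridPayoff
  rw [integral_finsetSum _ fun j _ =>
    ((hint _).const_mul _).indicator (M.measurableSet_gridExit A y k j), Finset.sum_mul]
  refine Finset.sum_congr rfl fun j _ => ?_
  rw [integral_indicator (M.measurableSet_gridExit A y k j), integral_const_mul, mul_assoc,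
    gridExit_eq]
  congr 1
  exact M.setIntegral_comp_pathFrom x y (j + 1) (gridTime k) (gridTime_monotone k)
    (by simp [gridTime]) _ (fun z hz => hz.1) hF hB

/-- Once the mesh is small, the grid exit occurs at most one mesh after `T`, while the path still
sits at `Y_T`. The only error is then a small delay, which `hF` absorbs. -/
lemma tendsto_gridPayoff (M : MarkovChain G Ω) (A : Set ℝ) (q : ℂ) (y : S)
    {F : RightContinuousPath S → ℂ} (hF : ∀ w, Tendsto (fun ε => F (shift ε w)) (𝓝 0) (𝓝 (F w)))
    (ω : Ω) :
    Tendsto (fun k => M.gridPayoff A q y F k ω) atTop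
      (𝓝 (M.payoffAt (M.passageTime A) q (fun z => if z = y then 1 else 0) ω *
        F (M.pathFrom (M.passageTime A ω).toNNReal ω))) := by
  by_cases hfin : M.passageTime A ω < ∞
  swap
  · have hzero : ∀ k, M.gridPayoff A q y F k ω = 0 := fun k =>
      M.gridPayoff_eq_zero F fun j _ hω => hfin <|
        (M.passageTime_le (gridTime_succ_pos k j) (hω.1.symm ▸ hω.2.1)).trans_lt
          ENNReal.coe_lt_top
    simp [hzero, payoffAt, hfin]
  obtain ⟨T, hT⟩ : ∃ T : ℝ≥0, (T : ℝ≥0∞) = M.passageTime A ω :=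
    ⟨_, ENNReal.coe_toNNReal hfin.ne⟩
  have hexit : ∀ t : ℝ≥0, 0 < t → (M.Y t ω : ℝ) ∉ A → T ≤ t := fun t h0 hA => by
    have := M.passageTime_le h0 hA
    rw [← hT] at this
    exact_mod_cast this
  -- The payoff as seen with a delay `ε` after `T`.
  let ψ : ℝ≥0 → ℂ := fun ε => if M.Y T ω = y then
    Complex.exp (-(q * (((T + ε : ℝ≥0) : ℝ) : ℂ))) * F (shift ε (M.pathFrom T ω)) else 0
  have hlim : M.payoffAt (M.passageTime A) q (fun z => if z = y then 1 else 0) ω *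
      F (M.pathFrom (M.passageTime A ω).toNNReal ω) =
      if M.Y T ω = y then Complex.exp (-(q * ((T : ℝ) : ℂ))) * F (M.pathFrom T ω) else 0 := by
    rw [payoffAt, if_pos hfin, ← hT, ENNReal.coe_toReal, ENNReal.toNNReal_coe]
    split_ifs <;> simp
  rw [hlim]
  have hψ : Tendsto ψ (𝓝 0)
      (𝓝 (if M.Y T ω = y then Complex.exp (-(q * ((T : ℝ) : ℂ))) * F (M.pathFrom T ω) else 0)) := by
    by_cases hy : M.Y T ω = y
    · simp only [ψ, if_pos hy]
      refine Tendsto.mul ?_ (hF _)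
      have : Continuous fun ε : ℝ≥0 => Complex.exp (-(q * (((T + ε : ℝ≥0) : ℝ) : ℂ))) := by
        fun_prop
      simpa using this.tendsto 0
    · simp only [ψ, if_neg hy]
      exact tendsto_const_nhds
  obtain ⟨δ, hδ, hconst⟩ := M.exists_constant_right ω T
  have hYT := M.notMem_of_passageTime_eq hT.symm
  have hmesh : Tendsto (fun k : ℕ => 1 / ((k : ℝ≥0) + 1)) atTop (𝓝 0) :=
    tendsto_one_div_add_atTop_nhds_zero_nat
  have hkey : ∀ᶠ k : ℕ in atTop, ∃ ε : ℝ≥0, ε ≤ 1 / ((k : ℝ≥0) + 1) ∧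
      M.gridPayoff A q y F k ω = ψ ε := by
    obtain ⟨K, hK⟩ := exists_nat_gt T
    filter_upwards [hmesh.eventually (gt_mem_nhds (tsub_pos_of_lt hδ)), eventually_ge_atTop K]
      with k hk hKk
    have hpos : (0 : ℝ≥0) < (k : ℝ≥0) + 1 := by positivity
    have hbetween : T ≤ gridTime k (⌊T * ((k : ℝ≥0) + 1)⌋₊ + 1) := by
      rw [gridTime, le_div_iff₀ hpos]
      exact_mod_cast (Nat.lt_floor_add_one (T * ((k : ℝ≥0) + 1))).le
    have hbound : gridTime k (⌊T * ((k : ℝ≥0) + 1)⌋₊ + 1) ≤ T + 1 / ((k : ℝ≥0) + 1) := by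
      rw [gridTime, div_le_iff₀ hpos, add_mul, div_mul_cancel₀ _ hpos.ne', Nat.cast_add,
        Nat.cast_one]
      gcongr
      exact Nat.floor_le (by positivity)
    have hmeshδ : T + 1 / ((k : ℝ≥0) + 1) < δ := lt_tsub_iff_left.1 hk
    have hex : ∃ j, (M.Y (gridTime k (j + 1)) ω : ℝ) ∉ A := by
      refine ⟨⌊T * ((k : ℝ≥0) + 1)⌋₊, ?_⟩
      rw [hconst _ hbetween (hbound.trans_lt hmeshδ)]
      exact hYT
    classical
    have hjle : Nat.find hex ≤ ⌊T * ((k : ℝ≥0) + 1)⌋₊ := by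
      refine Nat.find_min' hex ?_
      rw [hconst _ hbetween (hbound.trans_lt hmeshδ)]
      exact hYT
    have hjmin : ∀ i < Nat.find hex, (M.Y (gridTime k (i + 1)) ω : ℝ) ∈ A := fun i hi =>
      not_not.1 (Nat.find_min hex hi)
    have hjA := Nat.find_spec hex
    generalize Nat.find hex = j at hjle hjmin hjA
    have hTj : T ≤ gridTime k (j + 1) := hexit _ (gridTime_succ_pos k j) hjA
    have hjT : gridTime k (j + 1) ≤ T + 1 / ((k : ℝ≥0) + 1) :=
      (gridTime_monotone k (Nat.succ_le_succ hjle)).trans hbound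
    have hYj : M.Y (gridTime k (j + 1)) ω = M.Y T ω := hconst _ hTj (hjT.trans_lt hmeshδ)
    -- The `(k + 1) ^ 2` grid points reach time `k + 1`, which is beyond `T`, so the truncated sum
    -- contains the exit.
    have hjlt : j < (k + 1) ^ 2 := by
      have h1 : (j : ℝ≥0) ≤ T * ((k : ℝ≥0) + 1) :=
        le_trans (by exact_mod_cast hjle) (Nat.floor_le (by positivity))
      have h2 : T < (k : ℝ≥0) + 1 :=
        hK.trans_le (le_trans (by exact_mod_cast hKk) (le_add_of_nonneg_right zero_le_one))
      have h3 : (j : ℝ≥0) < ((k : ℝ≥0) + 1) ^ 2 := by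
        rw [sq]
        exact h1.trans_lt (mul_lt_mul_of_pos_right h2 hpos)
      exact_mod_cast h3
    refine ⟨gridTime k (j + 1) - T, tsub_le_iff_left.2 hjT, ?_⟩
    by_cases hy : M.Y T ω = y
    · rw [M.gridPayoff_eq_of_mem F hjlt ⟨hYj.trans hy, hy ▸ hYT, hjmin⟩]
      simp only [ψ, if_pos hy, shift_pathFrom, add_tsub_cancel_of_le hTj]
    · simp only [ψ, if_neg hy]
      refine M.gridPayoff_eq_zero F fun i _ hi => ?_
      rcases lt_trichotomy i j with h | h | h
      · exact hi.2.1 (hi.1 ▸ hjmin i h)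
      · exact hy (hYj.symm.trans (h ▸ hi.1))
      · exact hjA (hi.2.2 j h)
  refine tendsto_def.2 fun U hU => ?_
  obtain ⟨r, hr, hrU⟩ := NNReal.nhds_zero_basis.mem_iff.1 (hψ hU)
  filter_upwards [hkey, hmesh.eventually (gt_mem_nhds hr)] with k ⟨ε, hε, heq⟩ hkr
  rw [Set.mem_preimage, heq]
  exact hrU (hε.trans_lt hkr)

/-- The strong Markov property at the passage time `T_A`, on the event `Y_{T_A} = y`. -/
lemma integral_payoffAt_passageTime_mul (M : MarkovChain G Ω) (A : Set ℝ) {q : ℂ} (hq : 0 < q.re)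
    (x y : S) {F : RightContinuousPath S → ℂ} (hFm : Measurable F) {B : ℝ} (hB : ∀ w, ‖F w‖ ≤ B)
    (hF : ∀ w, Tendsto (fun ε => F (shift ε w)) (𝓝 0) (𝓝 (F w))) :
    ∫ ω, M.payoffAt (M.passageTime A) q (fun z => if z = y then 1 else 0) ω *
        F (M.pathFrom (M.passageTime A ω).toNNReal ω) ∂(M.P x) =
      (∫ ω, M.payoffAt (M.passageTime A) q (fun z => if z = y then 1 else 0) ω ∂(M.P x)) *
        ∫ w, F w ∂(M.canonical.P y) := by
  have hlim : ∀ {F : RightContinuousPath S → ℂ}, Measurable F → ∀ {B : ℝ}, (∀ w, ‖F w‖ ≤ B) →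
      (∀ w, Tendsto (fun ε => F (shift ε w)) (𝓝 0) (𝓝 (F w))) →
      Tendsto (fun k => ∫ ω, M.gridPayoff A q y F k ω ∂(M.P x)) atTop
        (𝓝 (∫ ω, M.payoffAt (M.passageTime A) q (fun z => if z = y then 1 else 0) ω *
          F (M.pathFrom (M.passageTime A ω).toNNReal ω) ∂(M.P x))) :=
    fun {F} hFm {B} hB hF => tendsto_integral_of_dominated_convergence (fun _ => B)
      (fun k => (M.measurable_gridPayoff A q y hFm k).aestronglyMeasurable)
      (integrable_const B) (fun k => ae_of_all _ (M.norm_gridPayoff_le A hq y hB k))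
      (ae_of_all _ (M.tendsto_gridPayoff A q y hF))
  have h1 := hlim hFm hB hF
  -- With `F = 1` the limit of the scalar factor alone is obtained; uniqueness of limits then gives
  -- the factorisation.
  have h2 := hlim (F := fun _ => 1) measurable_const (B := 1) (fun _ => by simp)
    (fun _ => tendsto_const_nhds)
  have hone : ∀ w, ‖(fun _ : RightContinuousPath S => (1 : ℂ)) w‖ ≤ 1 := fun _ => by simp
  simp only [M.integral_gridPayoff A q x y measurable_const hone, mul_one, integral_const,
    probReal_univ, one_smul] at h2
  simp only [M.integral_gridPayoff A q x y hFm hB] at h1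
  exact tendsto_nhds_unique h1 (h2.mul_const _)

end MarkovChain

namespace MarkovChain

open Filter Topology RightContinuousPath

variable {S : Finset ℝ} {G : Matrix S S ℝ} {Ω : Type*} [MeasurableSpace Ω]
  {Ω' : Type*} [MeasurableSpace Ω']

/-! ### Drawdown times of shifted paths -/

/-- The next drawdown involves only times from the `m`-th one on, and by `h` these are all at least
`s`. -/
lemma drawdownTime_succ_eq_add (M : MarkovChain G Ω) (M' : MarkovChain G Ω') {a : ℝ} (ha : 0 < a)
    {s : ℝ≥0} {ω : Ω} {ω' : Ω'} (hY : ∀ t, M.Y (s + t) ω = M'.Y t ω') {m j : ℕ}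
    (h : M.drawdownTime a m ω = s + M'.drawdownTime a j ω') :
    M.drawdownTime a (m + 1) ω = s + M'.drawdownTime a (j + 1) ω' := by
  refine eq_of_forall_gt_iff fun c => ?_
  rw [← lt_tsub_iff_left, M.drawdownTime_succ_lt_iff ha, M'.drawdownTime_succ_lt_iff ha]
  constructor
  · rintro ⟨u, t, hut, hle, hd, hc⟩
    rw [h] at hle
    have hsu : s ≤ u := by
      have := le_self_add.trans hle
      exact_mod_cast this
    obtain ⟨u', rfl⟩ := exists_add_of_le hsu
    obtain ⟨t', rfl⟩ := exists_add_of_le (hsu.trans hut)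
    rw [hY, hY] at hd
    refine ⟨u', t', (add_le_add_iff_left s).1 hut, ?_, hd, ?_⟩
    · rw [ENNReal.coe_add] at hle
      exact (ENNReal.add_le_add_iff_left ENNReal.coe_ne_top).1 hle
    · rwa [lt_tsub_iff_left, ← ENNReal.coe_add]
  · rintro ⟨u, t, hut, hle, hd, hc⟩
    refine ⟨s + u, s + t, add_le_add_right hut s, ?_, ?_, ?_⟩
    · rw [h, ENNReal.coe_add]
      exact add_le_add_right hle _
    · rwa [hY, hY]
    · rwa [lt_tsub_iff_left, ← ENNReal.coe_add] at hc

lemma drawdownTime_add_eq_add (M : MarkovChain G Ω) (M' : MarkovChain G Ω') {a : ℝ} (ha : 0 < a)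
    {s : ℝ≥0} {ω : Ω} {ω' : Ω'} (hY : ∀ t, M.Y (s + t) ω = M'.Y t ω') {m j : ℕ}
    (h : M.drawdownTime a m ω = s + M'.drawdownTime a j ω') (i : ℕ) :
    M.drawdownTime a (m + i) ω = s + M'.drawdownTime a (j + i) ω' := by
  induction i with
  | zero => exact h
  | succ i ih => exact M.drawdownTime_succ_eq_add M' ha hY ih

/-- If no drawdown of size `a` occurs before `s` and the path is at its maximum at `s`, then the
drawdown times can be computed from the path after `s`. -/
lemma drawdownTime_succ_of_isMax (M : MarkovChain G Ω) (M' : MarkovChain G Ω') {a : ℝ}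
    (ha : 0 < a) {s : ℝ≥0} {ω : Ω} {ω' : Ω'} (hY : ∀ t, M.Y (s + t) ω = M'.Y t ω')
    (hmax : ∀ u ≤ s, M.Y u ω ≤ M.Y s ω)
    (hno : ∀ u v, u ≤ v → v < s → (M.Y u ω : ℝ) - (M.Y v ω : ℝ) < a) (n : ℕ) :
    M.drawdownTime a (n + 1) ω = s + M'.drawdownTime a (n + 1) ω' := by
  have hone : M.drawdownTime a (0 + 1) ω = s + M'.drawdownTime a (0 + 1) ω' := by
    refine eq_of_forall_gt_iff fun c => ?_
    rw [← lt_tsub_iff_left, M.drawdownTime_succ_lt_iff ha, M'.drawdownTime_succ_lt_iff ha]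
    constructor
    · rintro ⟨u, t, hut, -, hd, hc⟩
      have hst : s ≤ t := not_lt.1 fun hts => (hno u t hut hts).not_ge hd
      obtain ⟨t', rfl⟩ := exists_add_of_le hst
      have hc' : (t' : ℝ≥0∞) < c - s := by rwa [lt_tsub_iff_left, ← ENNReal.coe_add]
      rw [hY] at hd
      rcases le_total s u with hsu | hus
      · obtain ⟨u', rfl⟩ := exists_add_of_le hsu
        rw [hY] at hd
        exact ⟨u', t', (add_le_add_iff_left s).1 hut, zero_le, hd, hc'⟩
      -- A peak before `s` may be replaced by the value at `s`, which is at least as high.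
      · refine ⟨0, t', zero_le, zero_le, ?_, hc'⟩
        have h1 : (M.Y u ω : ℝ) ≤ M.Y s ω := hmax u hus
        rw [← hY 0, add_zero]
        linarith
    · rintro ⟨u, t, hut, -, hd, hc⟩
      refine ⟨s + u, s + t, add_le_add_right hut s, zero_le, ?_, ?_⟩
      · rwa [hY, hY]
      · rwa [lt_tsub_iff_left, ← ENNReal.coe_add] at hc
  rw [add_comm n 1]
  simpa using M.drawdownTime_add_eq_add M' ha hY hone n

lemma payoffAt_eq_exp_mul (M : MarkovChain G Ω) (M' : MarkovChain G Ω') {s : ℝ≥0} {ω : Ω}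
    {ω' : Ω'} (hY : ∀ t, M.Y (s + t) ω = M'.Y t ω') {σ : Ω → ℝ≥0∞} {σ' : Ω' → ℝ≥0∞}
    (h : σ ω = s + σ' ω') (q : ℂ) (g : S → ℂ) :
    M.payoffAt σ q g ω = Complex.exp (-(q * ((s : ℝ) : ℂ))) * M'.payoffAt σ' q g ω' := by
  by_cases hfin : σ' ω' < ∞
  · obtain ⟨r, hr⟩ : ∃ r : ℝ≥0, (r : ℝ≥0∞) = σ' ω' := ⟨_, ENNReal.coe_toNNReal hfin.ne⟩
    rw [← hr, ← ENNReal.coe_add] at h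
    rw [payoffAt, payoffAt, h, ← hr, if_pos ENNReal.coe_lt_top, if_pos ENNReal.coe_lt_top,
      ENNReal.coe_toReal, ENNReal.coe_toReal, ENNReal.toNNReal_coe, ENNReal.toNNReal_coe, hY,
      ← mul_assoc, ← Complex.exp_add, NNReal.coe_add, Complex.ofReal_add, mul_add, neg_add]
  · have : ¬ σ ω < ∞ := by
      rw [h, not_lt_top_iff.1 hfin, add_top]
      exact lt_irrefl _
    rw [payoffAt, payoffAt, if_neg hfin, if_neg this, mul_zero]

lemma canonical_drawdownPayoff (M : MarkovChain G Ω) {a : ℝ} (ha : 0 < a) (f : S → ℂ) (n : ℕ)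
    (q : ℂ) (ω : Ω) :
    M.canonical.drawdownPayoff a f n q (M.pathFrom 0 ω) = M.drawdownPayoff a f n q ω := by
  have hY : ∀ t, M.Y (0 + t) ω = M.canonical.Y t (M.pathFrom 0 ω) := fun _ => rfl
  have h := M.drawdownTime_add_eq_add M.canonical ha hY (m := 0) (j := 0)
    (by simp [drawdownTime]) n
  rw [zero_add] at h
  rw [drawdownPayoff_eq, drawdownPayoff_eq, M.payoffAt_eq_exp_mul M.canonical hY h]
  simp

lemma integral_canonical_drawdownPayoff (M : MarkovChain G Ω) {a : ℝ} (ha : 0 < a) (f : S → ℂ)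
    (n : ℕ) (q : ℂ) (y : S) :
    ∫ w, M.canonical.drawdownPayoff a f n q w ∂(M.canonical.P y) =
      M.drawdownExpectation a f n q y := by
  have hm : Measurable (M.canonical.drawdownPayoff a f n q) :=
    M.canonical.measurable_payoffAt (M.canonical.measurable_drawdownTime ha n) q f
  refine (integral_map (M.measurable_pathFrom 0).aemeasurable hm.aestronglyMeasurable).trans ?_
  exact integral_congr_ae (ae_of_all _ (M.canonical_drawdownPayoff ha f n q))

/-- For small `ε` the path is constant up to `ε`, so the shift lowers each drawdown time of index at
least one by exactly `ε` and multiplies the payoff by `exp (q ε)`. For index zero the payoff does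
not change. -/
lemma tendsto_canonical_drawdownPayoff_shift (M : MarkovChain G Ω) {a : ℝ} (ha : 0 < a)
    (f : S → ℂ) (n : ℕ) (q : ℂ) (w : RightContinuousPath S) :
    Tendsto (fun ε => M.canonical.drawdownPayoff a f n q (shift ε w)) (𝓝 0)
      (𝓝 (M.canonical.drawdownPayoff a f n q w)) := by
  obtain ⟨δ, hδ, hconst⟩ := M.canonical.exists_constant_right w 0
  cases n with
  | zero =>
    refine tendsto_const_nhds.congr' ?_
    filter_upwards [gt_mem_nhds hδ] with ε hε
    simp only [drawdownPayoff, drawdownTime, ENNReal.zero_lt_top, if_true, ENNReal.toReal_zero,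
      ENNReal.toNNReal_zero]
    congr 2
    exact (hconst (ε + 0) zero_le (by rwa [add_zero])).symm
  | succ n =>
    have hlim : Tendsto (fun ε : ℝ≥0 => Complex.exp (q * ((ε : ℝ) : ℂ)) *
        M.canonical.drawdownPayoff a f (n + 1) q w) (𝓝 0)
        (𝓝 (M.canonical.drawdownPayoff a f (n + 1) q w)) := by
      have : Continuous fun ε : ℝ≥0 => Complex.exp (q * ((ε : ℝ) : ℂ)) *
        M.canonical.drawdownPayoff a f (n + 1) q w := by fun_prop
      simpa using this.tendsto 0
    refine hlim.congr' ?_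
    filter_upwards [gt_mem_nhds hδ] with ε hε
    have hY : ∀ t, M.canonical.Y (ε + t) w = M.canonical.Y t (shift ε w) := fun _ => rfl
    have hτ := M.canonical.drawdownTime_succ_of_isMax M.canonical ha hY
      (fun u hu => by rw [hconst u zero_le (hu.trans_lt hε), hconst ε zero_le hε])
      (fun u v huv hv => by
        rw [hconst u zero_le ((huv.trans_lt hv).trans hε), hconst v zero_le (hv.trans hε), sub_self]
        exact ha) n
    rw [drawdownPayoff_eq, M.canonical.payoffAt_eq_exp_mul M.canonical hY hτ, ← mul_assoc,
      ← Complex.exp_add, add_neg_cancel, Complex.exp_zero, one_mul]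

/-! ### Decomposition at the passage time -/

lemma mem_of_lt_passageTime (M : MarkovChain G Ω) {A : Set ℝ} {ω : Ω} (h0 : (M.Y 0 ω : ℝ) ∈ A)
    {t : ℝ≥0} (ht : (t : ℝ≥0∞) < M.passageTime A ω) : (M.Y t ω : ℝ) ∈ A := by
  rcases eq_zero_or_pos t with rfl | hpos
  · exact h0
  · exact not_not.1 fun hA => (M.passageTime_le hpos hA).not_gt ht

lemma passageTime_le_drawdownTime_succ (M : MarkovChain G Ω) {a : ℝ} (ha : 0 < a) {b : ℝ} {ω : Ω}
    (h0 : (M.Y 0 ω : ℝ) ∈ Set.Ioc (b - a) b) (n : ℕ) :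
    M.passageTime (Set.Ioc (b - a) b) ω ≤ M.drawdownTime a (n + 1) ω := by
  refine le_of_forall_gt fun c hc => ?_
  obtain ⟨u, t, hut, -, hd, htc⟩ := (M.drawdownTime_succ_lt_iff ha n ω c).1 hc
  refine lt_of_le_of_lt (not_lt.1 fun ht => ?_) htc
  have h1 := M.mem_of_lt_passageTime h0 ht
  have h2 := M.mem_of_lt_passageTime h0 (lt_of_le_of_lt (by exact_mod_cast hut) ht)
  linarith [h1.1, h2.2]

/-- The pair of times `0` and `T` witnesses a drop of at least `a`, so the first drawdown time is
`T` itself and the count restarts one lower. -/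
lemma drawdownTime_succ_of_down (M : MarkovChain G Ω) (M' : MarkovChain G Ω') {a : ℝ} (ha : 0 < a)
    {b : ℝ} {ω : Ω} {ω' : Ω'} {T : ℝ≥0} (h0 : (M.Y 0 ω : ℝ) = b)
    (hT : M.passageTime (Set.Ioc (b - a) b) ω = T) (hdown : (M.Y T ω : ℝ) ≤ b - a)
    (hY : ∀ t, M.Y (T + t) ω = M'.Y t ω') (n : ℕ) :
    M.drawdownTime a (n + 1) ω = T + M'.drawdownTime a n ω' := by
  have hone : M.drawdownTime a (0 + 1) ω = T + M'.drawdownTime a 0 ω' := by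
    have h0' : (M.Y 0 ω : ℝ) ∈ Set.Ioc (b - a) b := by
      rw [h0]
      exact ⟨by linarith, le_rfl⟩
    rw [drawdownTime, add_zero]
    refine le_antisymm (le_of_forall_gt fun c hc => ?_)
      (hT ▸ M.passageTime_le_drawdownTime_succ ha h0' 0)
    exact (M.drawdownTime_succ_lt_iff ha 0 ω c).2
      ⟨0, T, zero_le, le_rfl, by rw [h0]; linarith, hc⟩
  have := M.drawdownTime_add_eq_add M' ha hY hone n
  rwa [zero_add, zero_add, add_comm 1 n] at this

lemma drawdownTime_succ_of_up (M : MarkovChain G Ω) (M' : MarkovChain G Ω') {a : ℝ} (ha : 0 < a)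
    {b : ℝ} {ω : Ω} {ω' : Ω'} {T : ℝ≥0} (h0 : (M.Y 0 ω : ℝ) ∈ Set.Ioc (b - a) b)
    (hT : M.passageTime (Set.Ioc (b - a) b) ω = T) (hup : b < M.Y T ω)
    (hY : ∀ t, M.Y (T + t) ω = M'.Y t ω') (n : ℕ) :
    M.drawdownTime a (n + 1) ω = T + M'.drawdownTime a (n + 1) ω' := by
  have hmem : ∀ u < T, (M.Y u ω : ℝ) ∈ Set.Ioc (b - a) b := fun u hu =>
    M.mem_of_lt_passageTime h0 (by rw [hT]; exact_mod_cast hu)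
  refine M.drawdownTime_succ_of_isMax M' ha hY (fun u hu => ?_) (fun u v huv hv => ?_) n
  · rcases hu.eq_or_lt with rfl | hu
    · exact le_rfl
    · exact ((hmem u hu).2.trans_lt hup).le
  · linarith [(hmem u (huv.trans_lt hv)).2, (hmem v hv).1]

/-- The path functional whose expectation under `P_y` remains to be collected when the chain
started at `b` leaves `(b - a, b]` to the state `y`. -/
noncomputable def residualPayoff (M : MarkovChain G Ω) (a : ℝ) (f : S → ℂ) (n : ℕ) (q : ℂ) (b : ℝ)
    (y : S) (w : RightContinuousPath S) : ℂ :=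
  if (y : ℝ) ≤ b - a then M.canonical.drawdownPayoff a f n q w
  else if b < y then M.canonical.drawdownPayoff a f (n + 1) q w else 0

/-- Only the term `y = Y_T` survives. Since `Y_T` lies outside `(b - a, b]`, the zero branch of
`residualPayoff` is never the one selected. -/
lemma drawdownPayoff_succ_eq_sum (M : MarkovChain G Ω) {a : ℝ} (ha : 0 < a) (f : S → ℂ) (n : ℕ)
    (q : ℂ) {b : ℝ} {ω : Ω} (h0 : (M.Y 0 ω : ℝ) = b) :
    M.drawdownPayoff a f (n + 1) q ω = ∑ y,
      M.payoffAt (M.passageTime (Set.Ioc (b - a) b)) q (fun z => if z = y then 1 else 0) ω *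
        M.residualPayoff a f n q b y
          (M.pathFrom (M.passageTime (Set.Ioc (b - a) b) ω).toNNReal ω) := by
  have h0' : (M.Y 0 ω : ℝ) ∈ Set.Ioc (b - a) b := by
    rw [h0]
    exact ⟨by linarith, le_rfl⟩
  by_cases hfin : M.passageTime (Set.Ioc (b - a) b) ω < ∞
  swap
  · have hτ : ¬ M.drawdownTime a (n + 1) ω < ∞ := fun h =>
      hfin ((M.passageTime_le_drawdownTime_succ ha h0' n).trans_lt h)
    simp [drawdownPayoff, payoffAt, hfin, hτ]
  obtain ⟨T, hT⟩ : ∃ T : ℝ≥0, M.passageTime (Set.Ioc (b - a) b) ω = T :=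
    ⟨_, (ENNReal.coe_toNNReal hfin.ne).symm⟩
  have hY : ∀ t, M.Y (T + t) ω = M.canonical.Y t (M.pathFrom T ω) := fun _ => rfl
  rw [Finset.sum_eq_single (M.Y T ω)]
  · have hleft : M.payoffAt (M.passageTime (Set.Ioc (b - a) b)) q
        (fun z => if z = M.Y T ω then 1 else 0) ω = Complex.exp (-(q * ((T : ℝ) : ℂ))) := by
      rw [payoffAt, if_pos hfin, hT, ENNReal.coe_toReal, ENNReal.toNNReal_coe, if_pos rfl, mul_one]
    rw [hleft, hT, ENNReal.toNNReal_coe, drawdownPayoff_eq]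
    by_cases hdown : (M.Y T ω : ℝ) ≤ b - a
    · rw [residualPayoff, if_pos hdown]
      exact M.payoffAt_eq_exp_mul M.canonical hY
        (M.drawdownTime_succ_of_down M.canonical ha h0 hT hdown hY n) q f
    · have hup : b < M.Y T ω := not_le.1 fun h =>
        M.notMem_of_passageTime_eq hT ⟨not_le.1 hdown, h⟩
      rw [residualPayoff, if_neg hdown, if_pos hup]
      exact M.payoffAt_eq_exp_mul M.canonical hY
        (M.drawdownTime_succ_of_up M.canonical ha h0' hT hup hY n) q f
  · intro y _ hy
    rw [payoffAt, if_pos hfin, hT, ENNReal.toNNReal_coe, if_neg hy.symm, mul_zero, zero_mul]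
  · exact fun h => absurd (Finset.mem_univ _) h

/-- Expand `g` in indicators of states, so that both sides of the final system become sums over the
exit state. -/
lemma integral_payoffAt_eq_sum (M : MarkovChain G Ω) {σ : Ω → ℝ≥0∞} (hσ : Measurable σ) {q : ℂ}
    (hq : 0 < q.re) (g : S → ℂ) (x : S) :
    ∫ ω, M.payoffAt σ q g ω ∂(M.P x) =
      ∑ y, (∫ ω, M.payoffAt σ q (fun z => if z = y then 1 else 0) ω ∂(M.P x)) * g y := by
  simp_rw [← integral_mul_const]
  rw [← integral_finsetSum _ fun y _ => (M.integrable_payoffAt hσ hq _ _).mul_const _]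
  refine integral_congr_ae (ae_of_all _ fun ω => ?_)
  by_cases h : σ ω < ∞
  · simp [payoffAt, h]
  · simp [payoffAt, h]

lemma drawdownExpectation_succ (M : MarkovChain G Ω) {a : ℝ} (ha : 0 < a) (f : S → ℂ) (n : ℕ)
    {q : ℂ} (hq : 0 < q.re) (x : S) :
    M.drawdownExpectation a f (n + 1) q x = ∑ y,
      (∫ ω, M.payoffAt (M.passageTime (Set.Ioc ((x : ℝ) - a) x)) q
        (fun z => if z = y then 1 else 0) ω ∂(M.P x)) *
      (if (y : ℝ) ≤ x - a then M.drawdownExpectation a f n q y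
        else if (x : ℝ) < y then M.drawdownExpectation a f (n + 1) q y else 0) := by
  have hmeas : ∀ m, Measurable (M.canonical.drawdownPayoff a f m q) := fun m =>
    M.canonical.measurable_payoffAt (M.canonical.measurable_drawdownTime ha m) q f
  have hbound : ∀ m w, ‖M.canonical.drawdownPayoff a f m q w‖ ≤ ∑ z, ‖f z‖ := fun m w =>
    M.canonical.norm_payoffAt_le _ hq f w
  have hRm : ∀ y, Measurable (M.residualPayoff a f n q x y) := fun y => by
    unfold residualPayoff
    split_ifs
    exacts [hmeas n, hmeas (n + 1), measurable_const]
  have hRb : ∀ y w, ‖M.residualPayoff a f n q x y w‖ ≤ ∑ z, ‖f z‖ := fun y w => by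
    unfold residualPayoff
    split_ifs
    exacts [hbound n w, hbound (n + 1) w, by rw [norm_zero]; positivity]
  have hRt : ∀ y w, Tendsto (fun ε => M.residualPayoff a f n q x y (shift ε w)) (𝓝 0)
      (𝓝 (M.residualPayoff a f n q x y w)) := fun y w => by
    unfold residualPayoff
    split_ifs
    exacts [M.tendsto_canonical_drawdownPayoff_shift ha f n q w,
      M.tendsto_canonical_drawdownPayoff_shift ha f (n + 1) q w, tendsto_const_nhds]
  have hT := M.measurable_passageTime (Set.Ioc ((x : ℝ) - a) x)
  have hpath : Measurable fun ω =>
      M.pathFrom (M.passageTime (Set.Ioc ((x : ℝ) - a) x) ω).toNNReal ω :=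
    (measurable_pi_lambda _ fun t =>
      M.measurable_comp_time (hT.ennreal_toNNReal.add_const t)).subtype_mk
  have hsum : M.drawdownExpectation a f (n + 1) q x = ∫ ω, ∑ y,
      M.payoffAt (M.passageTime (Set.Ioc ((x : ℝ) - a) x)) q (fun z => if z = y then 1 else 0) ω *
        M.residualPayoff a f n q x y
          (M.pathFrom (M.passageTime (Set.Ioc ((x : ℝ) - a) x) ω).toNNReal ω) ∂(M.P x) := by
    refine integral_congr_ae ?_
    filter_upwards [M.ae_Y_zero x] with ω hω
    exact M.drawdownPayoff_succ_eq_sum ha f n q (congrArg Subtype.val hω)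
  rw [hsum, integral_finsetSum]
  · refine Finset.sum_congr rfl fun y _ => ?_
    rw [M.integral_payoffAt_passageTime_mul _ hq x y (hRm y) (hRb y) (hRt y)]
    congr 1
    unfold residualPayoff
    split_ifs
    · exact M.integral_canonical_drawdownPayoff ha f n q y
    · exact M.integral_canonical_drawdownPayoff ha f (n + 1) q y
    · exact integral_zero _ _
  · intro y _
    exact (M.integrable_payoffAt hT hq _ _).mul_bdd (c := ∑ z, ‖f z‖)
      ((hRm y).comp hpath).aestronglyMeasurable (ae_of_all _ fun ω => hRb y _)

end MarkovChain

/-! ### The initial condition and the linear system -/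

theorem mainTheorem5 {S : Finset ℝ} (G : Matrix S S ℝ) (hG : IsRateMatrix G)
    {Ω : Type*} [MeasurableSpace Ω] (M : MarkovChain G Ω)
    (a : ℝ) (ha : 0 < a) (f : S → ℂ) (q : ℂ) (hq : 0 < q.re) :
    -- the expectations in the statement are those of integrable random variables
    (∀ (n : ℕ) (x : S), Integrable (M.drawdownPayoff a f n q) (M.P x)) ∧
    (∀ (x : S) (g : S → ℂ),
      Integrable (M.passagePayoff (Set.Ioc ((x : ℝ) - a) x) (fun _ => q) g) (M.P x)) ∧
    -- initial condition
    (∀ x : S, M.drawdownExpectation a f 0 q x = f x) ∧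
    -- linear system
    (∀ n : ℕ, 1 ≤ n → ∀ x : S,
      M.drawdownExpectation a f n q x =
        M.passageExpectation (Set.Ioc ((x : ℝ) - a) x) (fun _ => q) x
          (fun z => if (z : ℝ) ≤ (x : ℝ) - a then M.drawdownExpectation a f (n - 1) q z else 0) +
        ∑ y ∈ Finset.univ.filter (fun y : S => x < y),
          M.passageExpectation (Set.Ioc ((x : ℝ) - a) x) (fun _ => q) x
            (fun z => if z = y then 1 else 0) * M.drawdownExpectation a f n q y) := by
  have hint : ∀ (x : S) (g : S → ℂ),
      Integrable (M.passagePayoff (Set.Ioc ((x : ℝ) - a) x) (fun _ => q) g) (M.P x) := fun x g => by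
    rw [M.passagePayoff_const]
    exact M.integrable_payoffAt (M.measurable_passageTime _) hq g _
  refine ⟨fun n x => M.integrable_payoffAt (M.measurable_drawdownTime ha n) hq f _, hint,
    fun x => ?_, fun n hn x => ?_⟩
  · have : M.drawdownPayoff a f 0 q =ᵐ[M.P x] fun _ => f x := by
      filter_upwards [M.ae_Y_zero x] with ω hω
      simp [MarkovChain.drawdownPayoff, MarkovChain.drawdownTime, hω]
    rw [MarkovChain.drawdownExpectation, integral_congr_ae this]
    simp
  · obtain ⟨n, rfl⟩ := Nat.exists_eq_add_of_le' hn
    simp only [MarkovChain.passageExpectation, M.passagePayoff_const, Nat.add_sub_cancel]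
    rw [M.integral_payoffAt_eq_sum (M.measurable_passageTime _) hq (fun z =>
        if (z : ℝ) ≤ (x : ℝ) - a then M.drawdownExpectation a f n q z else 0),
      M.drawdownExpectation_succ ha f n hq x, Finset.sum_filter, ← Finset.sum_add_distrib]
    -- The comparison is termwise in the exit state; `y ≤ x - a` and `x < y` exclude each other
    -- because `a > 0`.
    refine Finset.sum_congr rfl fun y _ => ?_
    by_cases hdown : (y : ℝ) ≤ x - a
    · have hxy : ¬ x < y := fun h => by
        have : (x : ℝ) < y := h
        linarith
      rw [if_pos hdown, if_neg hxy, add_zero, if_pos hdown]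
    · by_cases hxy : x < y
      · rw [if_neg hdown, if_pos (show (x : ℝ) < y from hxy), if_pos hxy, if_neg hdown, mul_zero,
          zero_add]
      · rw [if_neg hdown, if_neg (show ¬ (x : ℝ) < y from hxy), if_neg hxy, if_neg hdown, mul_zero,
          zero_add]
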